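/- For $\rho>0$ let $E_\rho(z)=\rho^2z^2+4\sin^2\frac z2$ for $z\in\mathbb C$, and for integers $k\ge 1$ let $w_k(\rho)=2\pi k+2i\operatorname{arcsinh}(k\pi\rho)$. Let $$I(\rho)=\int_{-\infty}^{\infty}\left(\frac{\rho^2+1}{\rho^2t^2+4\sin^2\frac t2}-\frac1{t^2}\right)dt .$$ For complex- or real-valued functions $f,g$ on $(0,\infty)$ write $f(\rho)\sim g(\rho)$ as $\rho\to0$ if for every $\varepsilon>0$ there is $\rho_0>0$ such that $|f(\rho)-g(\rho)|<\varepsilon|g(\rho)|$ for all $0<\rho<\rho_0$. Then for all $\rho>0$ and $k\ge1$ the function $E_\rho$ has a unique root $z_k(\rho)$ in the half-strip $\{z : (2k-1)\pi\le\operatorname{Re}z\le 2k\pi,\ \operatorname{Im}z>0\}$, and $E_\rho'(z_k(\rho))\ne0$, $E_\rho'(w_k(\rho))\neq 0$. For every $\rho>0$ the integral $I(\rho)$ and the series $$J(\rho)=\sum_{k=1}^\infty\frac1{E_\rho'(z_k(\rho))},\qquad \tilde J(\rho)=\sum_{k=1}^\infty\frac1{E_\rho'(w_k(\rho))}$$ converge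 absolutely. There are constants $C>0$ and $\rho_0>0$ such that for all $0<\rho<\rho_0$ and all $k\ge1$ $$\frac1{E_\rho'(z_k(\rho))}=\frac{1+\eta_k(\rho)}{E_\rho'(w_k(\rho))}\quad\text{for some } \eta_k(\rho)\in\mathbb C \text{ with } |\eta_k(\rho)|\le C\rho .$$ Moreover, as $\rho\to0$, $$J(\rho)\sim\tilde J(\rho)\qquad\text{and}\qquad I(\rho)\sim\frac{\log\frac1\rho}{\rho}.$$ -/

import Mathlib

open MeasureTheory

noncomputable section

namespace Helix

/-- The exponential polynomial `E_ρ(z) = ρ² z² + 4 sin² (z / 2)`. -/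
def E (ρ : ℝ) (z : ℂ) : ℂ :=
  (ρ : ℂ) ^ 2 * z ^ 2 + 4 * Complex.sin (z / 2) ^ 2

/-- `z` is a root of `E_ρ` in the half-strip `[(2k-1)π, 2kπ] × (0, ∞)`. -/
def IsStripRoot (ρ : ℝ) (k : ℕ) (z : ℂ) : Prop :=
  (2 * (k : ℝ) - 1) * Real.pi ≤ z.re ∧ z.re ≤ 2 * (k : ℝ) * Real.pi ∧ 0 < z.im ∧ E ρ z = 0

/-- `z_k(ρ)`: the root of `E_ρ` in the `k`-th half-strip, for `k ≥ 1` and `ρ > 0`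
(that it exists and is unique is part of the theorem). -/
def zRoot (ρ : ℝ) (k : ℕ) : ℂ :=
  Classical.epsilon (IsStripRoot ρ k)

/-- `w_k(ρ) = 2πk + 2i arcsinh (kπρ)`. -/
def wApprox (ρ : ℝ) (k : ℕ) : ℂ :=
  2 * (Real.pi : ℂ) * (k : ℂ) + 2 * Complex.I * (Real.arsinh ((k : ℝ) * Real.pi * ρ) : ℂ)

/-- `1 / E_ρ'(z_k(ρ))`. -/
def zTerm (ρ : ℝ) (k : ℕ) : ℂ := 1 / deriv (E ρ) (zRoot ρ k)

/-- `1 / E_ρ'(w_k(ρ))`. -/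
def wTerm (ρ : ℝ) (k : ℕ) : ℂ := 1 / deriv (E ρ) (wApprox ρ k)

/-- `J(ρ) = ∑_{k ≥ 1} 1 / E_ρ'(z_k(ρ))`. -/
def J (ρ : ℝ) : ℂ := ∑' k : ℕ, zTerm ρ (k + 1)

/-- `J̃(ρ) = ∑_{k ≥ 1} 1 / E_ρ'(w_k(ρ))`. -/
def JTilde (ρ : ℝ) : ℂ := ∑' k : ℕ, wTerm ρ (k + 1)

/-- The regularized, rescaled Möbius energy density of the helix
`t ↦ (cos t, sin t, ρ t)`. The singularity at `t = 0` is removable, so that the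
value there is irrelevant for the integral. -/
def M (ρ t : ℝ) : ℝ :=
  (ρ ^ 2 + 1) / (ρ ^ 2 * t ^ 2 + 4 * Real.sin (t / 2) ^ 2) - 1 / t ^ 2

/-- `I(ρ) = ∫_ℝ M_ρ(t) dt`. -/
def I (ρ : ℝ) : ℝ := ∫ t : ℝ, M ρ t

/-- Asymptotic equivalence `f(ρ) ∼ g(ρ)` as `ρ → 0`, for functions on `(0, ∞)`. -/
def AsympEquivAtZero {F : Type*} [NormedAddCommGroup F] (f g : ℝ → F) : Prop :=
  ∀ ε : ℝ, 0 < ε → ∃ ρ₀ : ℝ, 0 < ρ₀ ∧ ∀ ρ : ℝ, 0 < ρ → ρ < ρ₀ → ‖f ρ - g ρ‖ < ε * ‖g ρ‖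

end Helix

end

/-!
Writing `z = 2 (kπ + i w)` gives
`E_ρ(z) = 4 (ρ (kπ + i w) - sinh w) (ρ (kπ + i w) + sinh w)`, and in the `k`-th half-strip, which
is `Re w > 0`, `0 ≤ Im w ≤ π / 2`, the second factor has positive real part. So the roots there are
the solutions of `sinh w = ρ (kπ + i w)`.

Two solutions would satisfy `cosh m * sinh d = i ρ d`, with `m` their midpoint and `d` half their
difference; this contradicts `|cosh m| ≥ ρ π / 2` and Jordan's inequality `|sinh d| > (2 / π) |d|`
(`IsReducedRoot.unique`). A solution exists by the intermediate value theorem, the real part of the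
equation determining `Re w` from `Im w` (`exists_isReducedRoot`).

With `b = kπρ` and `c = cosh (arsinh b)`, the bound `|w| ≤ 4 b` gives `sinh w = b (1 + O(ρ))` and
`cosh w = c (1 + O(ρ))` uniformly in `k`. Both `E_ρ'(z_k)` and `E_ρ'(w_k)` are therefore
`4 i b c (1 + O(ρ))` (`norm_deriv_E_sub_le`). This compares the two series termwise; it compares
their sums because the terms of `J̃` lie in one sector, so that there is no cancellation
(`norm_JTilde_ge`).

For the integral no residues are needed. With `t = 2kπ + u`, `|u| ≤ π`, `k ≥ 1`, the density lies,
up to a bounded error, between the functions `1 / (c² + u²)` with `c = ρ (2k + 1) π` and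
`c = ρ (2k - 1) π`, whose integrals over `|u| ≤ π` are `π / c + O(1)`. Summing over `k ≤ 1 / ρ` yields
`log (1 / ρ) / (2 ρ) + O(1 / ρ)`, and the density is at most `1 / (ρ² t²)` beyond
(`abs_I_sub_le`).
-/

namespace Helix

/-! ### The strip coordinate -/

/-- The change of variables `z = 2 (kπ + i w)`, adapted to the `k`-th half-strip. -/
noncomputable def stripPoint (k : ℕ) (w : ℂ) : ℂ := 2 * (k * Real.pi + Complex.I * w)

/-- In the variable `w` of `stripPoint`, the roots of `E_ρ` in the `k`-th half-strip are the
solutions of `sinh w = ρ (kπ + i w)` in the half-strip `Re w > 0`, `0 ≤ Im w ≤ π / 2`. -/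
def IsReducedRoot (ρ : ℝ) (k : ℕ) (w : ℂ) : Prop :=
  0 < w.re ∧ 0 ≤ w.im ∧ w.im ≤ Real.pi / 2 ∧
    Complex.sinh w = ρ * (k * Real.pi + Complex.I * w)

lemma stripPoint_surjective (k : ℕ) (z : ℂ) : ∃ w, stripPoint k w = z :=
  ⟨Complex.I * (k * Real.pi - z / 2), by
    unfold stripPoint; linear_combination (2 * k * Real.pi - z) * Complex.I_mul_I⟩

lemma stripPoint_re (k : ℕ) (w : ℂ) : (stripPoint k w).re = 2 * (k * Real.pi - w.im) := by
  simp [stripPoint, sub_eq_add_neg]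

lemma stripPoint_im (k : ℕ) (w : ℂ) : (stripPoint k w).im = 2 * w.re := by
  simp [stripPoint]

lemma sinh_re (w : ℂ) : (Complex.sinh w).re = Real.sinh w.re * Real.cos w.im := by
  conv_lhs => rw [← Complex.re_add_im w, Complex.sinh_add, Complex.cosh_mul_I, Complex.sinh_mul_I]
  simp [← Complex.ofReal_sinh, ← Complex.ofReal_cosh, ← Complex.ofReal_sin, ← Complex.ofReal_cos]

lemma sinh_im (w : ℂ) : (Complex.sinh w).im = Real.cosh w.re * Real.sin w.im := by
  conv_lhs => rw [← Complex.re_add_im w, Complex.sinh_add, Complex.cosh_mul_I, Complex.sinh_mul_I]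
  simp [← Complex.ofReal_sinh, ← Complex.ofReal_cosh, ← Complex.ofReal_sin, ← Complex.ofReal_cos]

lemma cosh_re (w : ℂ) : (Complex.cosh w).re = Real.cosh w.re * Real.cos w.im := by
  conv_lhs => rw [← Complex.re_add_im w, Complex.cosh_add, Complex.cosh_mul_I, Complex.sinh_mul_I]
  simp [← Complex.ofReal_sinh, ← Complex.ofReal_cosh, ← Complex.ofReal_sin, ← Complex.ofReal_cos]

lemma cosh_im (w : ℂ) : (Complex.cosh w).im = Real.sinh w.re * Real.sin w.im := by
  conv_lhs => rw [← Complex.re_add_im w, Complex.cosh_add, Complex.cosh_mul_I, Complex.sinh_mul_I]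
  simp [← Complex.ofReal_sinh, ← Complex.ofReal_cosh, ← Complex.ofReal_sin, ← Complex.ofReal_cos]

lemma normSq_sinh (w : ℂ) :
    Complex.normSq (Complex.sinh w) = Real.sinh w.re ^ 2 + Real.sin w.im ^ 2 := by
  rw [Complex.normSq_apply, sinh_re, sinh_im]
  linear_combination Real.sin w.im ^ 2 * Real.cosh_sq w.re
    + Real.sinh w.re ^ 2 * Real.sin_sq_add_cos_sq w.im

lemma normSq_cosh (w : ℂ) :
    Complex.normSq (Complex.cosh w) = Real.sinh w.re ^ 2 + Real.cos w.im ^ 2 := by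
  rw [Complex.normSq_apply, cosh_re, cosh_im]
  linear_combination Real.cos w.im ^ 2 * Real.cosh_sq w.re
    + Real.sinh w.re ^ 2 * Real.sin_sq_add_cos_sq w.im

lemma sin_nat_mul_pi_add_sq (k : ℕ) (u : ℂ) :
    Complex.sin (k * Real.pi + u) ^ 2 = Complex.sin u ^ 2 := by
  have h := Complex.sin_sq_add_cos_sq ((k : ℂ) * Real.pi)
  rw [Complex.sin_nat_mul_pi] at h
  rw [Complex.sin_add, Complex.sin_nat_mul_pi]
  linear_combination Complex.sin u ^ 2 * h

lemma E_stripPoint (ρ : ℝ) (k : ℕ) (w : ℂ) :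
    E ρ (stripPoint k w) = 4 * (ρ * (k * Real.pi + Complex.I * w) - Complex.sinh w) *
      (ρ * (k * Real.pi + Complex.I * w) + Complex.sinh w) := by
  have h : stripPoint k w / 2 = k * Real.pi + w * Complex.I := by unfold stripPoint; ring
  rw [E, h, sin_nat_mul_pi_add_sq, Complex.sin_mul_I, stripPoint]
  linear_combination 4 * Complex.sinh w ^ 2 * Complex.I_sq

lemma isStripRoot_stripPoint_iff {ρ : ℝ} (hρ : 0 < ρ) {k : ℕ} (hk : 1 ≤ k) (w : ℂ) :
    IsStripRoot ρ k (stripPoint k w) ↔ IsReducedRoot ρ k w := by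
  have hk' : (1 : ℝ) ≤ k := by exact_mod_cast hk
  have hpi := Real.pi_pos
  rw [IsStripRoot, IsReducedRoot, stripPoint_re, stripPoint_im, E_stripPoint]
  constructor
  · rintro ⟨h1, h2, h3, h4⟩
    have hre : 0 < w.re := by linarith
    have him : 0 ≤ w.im := by linarith
    have him2 : w.im ≤ Real.pi / 2 := by linarith
    refine ⟨hre, him, him2, ?_⟩
    -- The second factor has positive real part on the half-strip.
    have hne : (ρ * (k * Real.pi + Complex.I * w) + Complex.sinh w : ℂ) ≠ 0 := by
      intro h0
      have h5 := congrArg Complex.re h0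
      rw [Complex.add_re, sinh_re] at h5
      simp at h5
      have h6 : 0 ≤ Real.sinh w.re * Real.cos w.im :=
        mul_nonneg (Real.sinh_nonneg_iff.2 hre.le)
          (Real.cos_nonneg_of_mem_Icc ⟨by linarith, him2⟩)
      have h7 : 0 < ρ * (k * Real.pi + -w.im) := mul_pos hρ (by nlinarith)
      linarith
    have h5 := (mul_eq_zero.1 h4).resolve_right hne
    linear_combination -h5 / 4
  · rintro ⟨h1, h2, h3, h4⟩
    refine ⟨by linarith, by linarith, by linarith, ?_⟩
    rw [h4]; ring

namespace IsReducedRoot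

variable {ρ : ℝ} {k : ℕ} {w : ℂ}

lemma sinh_mul_cos (h : IsReducedRoot ρ k w) :
    Real.sinh w.re * Real.cos w.im = ρ * (k * Real.pi - w.im) := by
  have h1 := congrArg Complex.re h.2.2.2
  rw [sinh_re] at h1
  simpa [sub_eq_add_neg] using h1

lemma cosh_mul_sin (h : IsReducedRoot ρ k w) :
    Real.cosh w.re * Real.sin w.im = ρ * w.re := by
  have h1 := congrArg Complex.im h.2.2.2
  rw [sinh_im] at h1
  simpa using h1

lemma le_sinh_mul_cos (hρ : 0 < ρ) (hk : 1 ≤ k) (h : IsReducedRoot ρ k w) :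
    ρ * k * (Real.pi / 2) ≤ Real.sinh w.re * Real.cos w.im := by
  have hk' : (1 : ℝ) ≤ k := by exact_mod_cast hk
  rw [h.sinh_mul_cos, mul_assoc]
  exact mul_le_mul_of_nonneg_left (by nlinarith [h.2.2.1, Real.pi_pos]) hρ.le

lemma le_sinh (hρ : 0 < ρ) (hk : 1 ≤ k) (h : IsReducedRoot ρ k w) :
    ρ * (Real.pi / 2) ≤ Real.sinh w.re := by
  have hk' : (1 : ℝ) ≤ k := by exact_mod_cast hk
  have h1 := h.le_sinh_mul_cos hρ hk
  have h2 : Real.sinh w.re * Real.cos w.im ≤ Real.sinh w.re * 1 :=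
    mul_le_mul_of_nonneg_left (Real.cos_le_one _) (Real.sinh_nonneg_iff.2 h.1.le)
  have h3 : ρ * 1 * (Real.pi / 2) ≤ ρ * k * (Real.pi / 2) := by gcongr
  linarith

end IsReducedRoot

/-! ### Existence and uniqueness of the root -/

/-- On the strip `|Im d| ≤ π / 4`, Jordan's inequality gives `|sinh d| ≥ (2 / π) |d|`; it is
strict away from `0`. -/
lemma normSq_lt_normSq_sinh {d : ℂ} (hd : d ≠ 0) (him : |d.im| ≤ Real.pi / 4) :
    (2 / Real.pi) ^ 2 * Complex.normSq d < Complex.normSq (Complex.sinh d) := by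
  have hpi := Real.pi_pos
  have hc0 : 0 < 2 / Real.pi := by positivity
  have hc : 2 / Real.pi < 1 := (div_lt_one hpi).2 (by linarith [Real.pi_gt_three])
  have hsinh : |d.re| ≤ |Real.sinh d.re| := by
    rw [Real.abs_sinh]; exact Real.self_le_sinh_iff.2 (abs_nonneg _)
  have h1 : d.re ^ 2 ≤ Real.sinh d.re ^ 2 := sq_le_sq.2 hsinh
  have h2 : (2 / Real.pi) ^ 2 * d.im ^ 2 ≤ Real.sin d.im ^ 2 := by
    rw [← mul_pow]; apply sq_le_sq.2
    rw [abs_mul, abs_of_pos hc0]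
    exact Real.mul_abs_le_abs_sin (by linarith)
  rw [normSq_sinh, Complex.normSq_apply]
  by_cases hr : d.re = 0
  · have hi : d.im ≠ 0 := fun hi => hd (Complex.ext hr hi)
    have h3 : (2 / Real.pi * |d.im|) ^ 2 < Real.sin |d.im| ^ 2 := by
      have := Real.mul_lt_sin (abs_pos.2 hi) (by linarith)
      gcongr
    have h4 : Real.sin |d.im| ^ 2 = Real.sin d.im ^ 2 := by
      rcases abs_cases d.im with h | h <;> simp [h.1]
    rw [mul_pow, sq_abs, h4] at h3
    rw [hr]; simp; linarith
  · have h3 : 0 < d.re ^ 2 := by positivity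
    have h4 : (2 / Real.pi) ^ 2 < 1 := by nlinarith
    nlinarith

lemma IsReducedRoot.unique {ρ : ℝ} (hρ : 0 < ρ) {k : ℕ} (hk : 1 ≤ k) {w₁ w₂ : ℂ}
    (h₁ : IsReducedRoot ρ k w₁) (h₂ : IsReducedRoot ρ k w₂) : w₁ = w₂ := by
  by_contra hne
  set m := (w₁ + w₂) / 2 with hm
  set d := (w₁ - w₂) / 2 with hd
  have hd0 : d ≠ 0 := fun h => hne (by linear_combination 2 * h)
  have hdim : d.im = (w₁.im - w₂.im) / 2 := by simp [d]
  have hmre : m.re = (w₁.re + w₂.re) / 2 := by simp [m]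
  have key : Complex.cosh m * Complex.sinh d = ρ * Complex.I * d := by
    have e1 : w₁ = m + d := by rw [hm, hd]; ring
    have e2 : w₂ = m - d := by rw [hm, hd]; ring
    have a1 := h₁.2.2.2
    have a2 := h₂.2.2.2
    rw [e1, Complex.sinh_add] at a1
    rw [e2, Complex.sinh_sub] at a2
    linear_combination (a1 - a2) / 2
  have hs := normSq_lt_normSq_sinh hd0 (by
    rw [hdim, abs_le]
    constructor <;> linarith [h₁.2.1, h₁.2.2.1, h₂.2.1, h₂.2.2.1])
  have hcosh : (ρ * (Real.pi / 2)) ^ 2 ≤ Complex.normSq (Complex.cosh m) := by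
    rw [normSq_cosh, hmre]
    have h3 : ρ * (Real.pi / 2) ≤ Real.sinh ((w₁.re + w₂.re) / 2) := by
      rcases le_total w₁.re w₂.re with h | h
      · exact (h₁.le_sinh hρ hk).trans (Real.sinh_le_sinh.2 (by linarith))
      · exact (h₂.le_sinh hρ hk).trans (Real.sinh_le_sinh.2 (by linarith))
    have h4 : 0 ≤ ρ * (Real.pi / 2) := by have := Real.pi_pos; positivity
    nlinarith [sq_nonneg (Real.cos m.im)]
  have hn := congrArg Complex.normSq key
  simp only [map_mul, Complex.normSq_ofReal, Complex.normSq_I] at hn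
  have hpos : 0 < (ρ * (Real.pi / 2)) ^ 2 := by have := Real.pi_pos; positivity
  have h5 := mul_lt_mul_of_pos_left hs hpos
  have h6 := mul_le_mul_of_nonneg_right hcosh (Complex.normSq_nonneg (Complex.sinh d))
  have h7 : (ρ * (Real.pi / 2)) ^ 2 * ((2 / Real.pi) ^ 2 * Complex.normSq d)
      = ρ * ρ * 1 * Complex.normSq d := by
    have := Real.pi_pos.ne'
    field_simp
  linarith

/-- The real part of `sinh w = ρ (kπ + i w)` determines `y = Re w` as a function of `s = Im w`;
the imaginary part then changes sign as `s` runs from `0` to near `π / 2`. -/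
lemma exists_isReducedRoot {ρ : ℝ} (hρ : 0 < ρ) {k : ℕ} (hk : 1 ≤ k) :
    ∃ w, IsReducedRoot ρ k w := by
  have hk' : (1 : ℝ) ≤ k := by exact_mod_cast hk
  have hpi := Real.pi_pos
  set y : ℝ → ℝ := fun s => Real.arsinh (ρ * (k * Real.pi - s) / Real.cos s) with hy
  set F : ℝ → ℝ := fun s => Real.cosh (y s) * Real.sin s - ρ * y s with hF
  -- `1 / cos s₁` is large enough to force `y s₁ ≥ 4 ρ`.
  obtain ⟨s₁, hs1, hs2, hs3, hs4⟩ : ∃ s, Real.pi / 6 ≤ s ∧ s < Real.pi / 2 ∧ 1 / 2 ≤ Real.sin s ∧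
      4 * ρ ≤ y s := by
    set c : ℝ := min (1 / 2) (ρ * (Real.pi / 2) / Real.sinh (4 * ρ)) with hc
    have hsh : 0 < Real.sinh (4 * ρ) := Real.sinh_pos_iff.2 (by linarith)
    have hc0 : 0 < c := lt_min (by norm_num) (by positivity)
    have hc1 : c ≤ 1 / 2 := min_le_left _ _
    have hcos : Real.cos (Real.arccos c) = c := Real.cos_arccos (by linarith) (by linarith)
    have hlt : Real.arccos c < Real.pi / 2 := Real.arccos_lt_pi_div_two.2 hc0
    have hge : Real.pi / 3 ≤ Real.arccos c := by
      by_contra! hcon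
      have := Real.cos_lt_cos_of_nonneg_of_le_pi (Real.arccos_nonneg c) (by linarith) hcon
      rw [hcos, Real.cos_pi_div_three] at this
      linarith
    refine ⟨Real.arccos c, by linarith, hlt, ?_, ?_⟩
    · rw [← Real.sin_pi_div_six]
      exact Real.sin_le_sin_of_le_of_le_pi_div_two (by linarith) hlt.le (by linarith)
    · simp only [hy]
      rw [hcos, ← Real.sinh_le_sinh, Real.sinh_arsinh, le_div_iff₀ hc0]
      have h1 : c ≤ ρ * (Real.pi / 2) / Real.sinh (4 * ρ) := min_le_right _ _
      rw [le_div_iff₀ hsh] at h1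
      have h2 : ρ * (Real.pi / 2) ≤ ρ * (k * Real.pi - Real.arccos c) :=
        mul_le_mul_of_nonneg_left (by nlinarith) hρ.le
      linarith
  have hcospos : ∀ s ∈ Set.Icc 0 s₁, 0 < Real.cos s := fun s hs =>
    Real.cos_pos_of_mem_Ioo ⟨by linarith [hs.1], by linarith [hs.2]⟩
  have hycont : ContinuousOn y (Set.Icc 0 s₁) := by
    refine Real.continuous_arsinh.comp_continuousOn ?_
    exact ContinuousOn.div (by fun_prop) (by fun_prop) fun s hs => (hcospos s hs).ne'
  have hFcont : ContinuousOn F (Set.Icc 0 s₁) :=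
    ((Real.continuous_cosh.comp_continuousOn hycont).mul (by fun_prop)).sub
      (continuousOn_const.mul hycont)
  have hypos : ∀ s ∈ Set.Icc 0 s₁, 0 < y s := fun s hs => by
    have : 0 < k * Real.pi - s := by nlinarith [hs.2]
    exact Real.arsinh_pos_iff.2 (div_pos (by positivity) (hcospos s hs))
  have h0s : 0 ≤ s₁ := by linarith
  have hF0 : F 0 ≤ 0 := by
    have := hypos 0 ⟨le_rfl, h0s⟩
    simp only [hF, Real.sin_zero]; nlinarith
  have hF1 : 0 ≤ F s₁ := by
    have h1 := hypos s₁ ⟨h0s, le_rfl⟩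
    have h3 : 1 + y s₁ ^ 2 / 2 ≤ Real.cosh (y s₁) := by
      have h4 : y s₁ / 2 ≤ Real.sinh (y s₁ / 2) := Real.self_le_sinh_iff.2 (by linarith)
      have h5 := Real.cosh_two_mul (y s₁ / 2)
      rw [mul_div_cancel₀ _ two_ne_zero, Real.cosh_sq] at h5
      nlinarith
    simp only [hF]
    nlinarith [mul_le_mul_of_nonneg_right hs3 (Real.cosh_pos (y s₁)).le,
      mul_le_mul_of_nonneg_right hs4 h1.le]
  obtain ⟨s, hs, hFs⟩ := intermediate_value_Icc h0s hFcont ⟨hF0, hF1⟩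
  refine ⟨⟨y s, s⟩, hypos s hs, hs.1, by linarith [hs.2], ?_⟩
  apply Complex.ext
  · rw [sinh_re]
    simp only [hy, Real.sinh_arsinh]
    rw [div_mul_cancel₀ _ (hcospos s hs).ne']
    simp [sub_eq_add_neg]
  · rw [sinh_im]
    simp only [hF] at hFs
    simp
    linarith

lemma exists_zRoot_eq {ρ : ℝ} (hρ : 0 < ρ) {k : ℕ} (hk : 1 ≤ k) :
    ∃ w, IsReducedRoot ρ k w ∧ zRoot ρ k = stripPoint k w ∧
      ∀ z, IsStripRoot ρ k z → z = stripPoint k w := by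
  obtain ⟨w, hw⟩ := exists_isReducedRoot hρ hk
  have huniq : ∀ z, IsStripRoot ρ k z → z = stripPoint k w := by
    intro z hz
    obtain ⟨w', rfl⟩ := stripPoint_surjective k z
    rw [((isStripRoot_stripPoint_iff hρ hk w').1 hz).unique hρ hk hw]
  exact ⟨w, hw, huniq _ (Classical.epsilon_spec
    ⟨_, (isStripRoot_stripPoint_iff hρ hk w).2 hw⟩), huniq⟩

/-! ### The derivative of `E` and convergence of the series -/

lemma wApprox_eq (ρ : ℝ) (k : ℕ) :
    wApprox ρ k = stripPoint k (Real.arsinh (k * Real.pi * ρ) : ℝ) := by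
  unfold wApprox stripPoint; ring

lemma deriv_E (ρ : ℝ) (z : ℂ) : deriv (E ρ) z = 2 * ρ ^ 2 * z + 2 * Complex.sin z := by
  have h1 : HasDerivAt (fun z : ℂ => z / 2) (1 / 2) z := (hasDerivAt_id z).div_const 2
  have h2 := ((hasDerivAt_pow 2 z).const_mul ((ρ : ℂ) ^ 2)).add
    (((h1.csin).pow 2).const_mul (4 : ℂ))
  have h3 : deriv (E ρ) z = _ := h2.deriv
  rw [h3]
  have h4 := Complex.sin_two_mul (z / 2)
  rw [mul_div_cancel₀ z two_ne_zero] at h4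
  rw [h4]; norm_num; ring

lemma deriv_E_stripPoint (ρ : ℝ) (k : ℕ) (w : ℂ) :
    deriv (E ρ) (stripPoint k w) =
      4 * (ρ ^ 2 * (k * Real.pi + Complex.I * w) +
        Complex.I * Complex.sinh w * Complex.cosh w) := by
  have h : Complex.sin (stripPoint k w) = Complex.sinh (2 * w) * Complex.I := by
    rw [← Complex.sin_mul_I, ← Complex.sin_add_nat_mul_two_pi (2 * w * Complex.I) k, stripPoint]
    congr 1; ring
  rw [deriv_E, h, Complex.sinh_two_mul, stripPoint]
  ring

lemma IsReducedRoot.deriv_E_eq {ρ : ℝ} {k : ℕ} {w : ℂ} (h : IsReducedRoot ρ k w) :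
    deriv (E ρ) (stripPoint k w) =
      4 * Complex.sinh w * (ρ + Complex.I * Complex.cosh w) := by
  rw [deriv_E_stripPoint]
  linear_combination (-4 * (ρ : ℂ)) * h.2.2.2

lemma deriv_E_wApprox (ρ : ℝ) (k : ℕ) :
    deriv (E ρ) (wApprox ρ k) =
      4 * ((ρ * (k * Real.pi * ρ) : ℝ) + Complex.I *
        (ρ ^ 2 * Real.arsinh (k * Real.pi * ρ) +
          k * Real.pi * ρ * Real.cosh (Real.arsinh (k * Real.pi * ρ)) : ℝ)) := by
  rw [wApprox_eq, deriv_E_stripPoint, ← Complex.ofReal_sinh, ← Complex.ofReal_cosh,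
    Real.sinh_arsinh]
  push_cast; ring

lemma IsReducedRoot.le_norm_deriv_E {ρ : ℝ} (hρ : 0 < ρ) {k : ℕ} (hk : 1 ≤ k) {w : ℂ}
    (h : IsReducedRoot ρ k w) : 4 * ρ ^ 2 * k ^ 2 ≤ ‖deriv (E ρ) (stripPoint k w)‖ := by
  have h1 := h.le_sinh_mul_cos hρ hk
  have h2 : ρ * k ≤ ρ * k * (Real.pi / 2) :=
    le_mul_of_one_le_right (by positivity) (by linarith [Real.pi_gt_three])
  have hcos : 0 ≤ Real.cos w.im :=
    Real.cos_nonneg_of_mem_Icc ⟨by linarith [h.2.1, Real.pi_pos], h.2.2.1⟩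
  have h3 : ρ * k ≤ ‖Complex.sinh w‖ := by
    refine le_trans ?_ ((le_abs_self _).trans (Complex.abs_re_le_norm _))
    rw [sinh_re]; linarith
  have h4 : ρ * k ≤ ‖(ρ + Complex.I * Complex.cosh w : ℂ)‖ := by
    refine le_trans ?_ ((le_abs_self _).trans (Complex.abs_im_le_norm _))
    have h5 := mul_le_mul_of_nonneg_right (Real.sinh_lt_cosh w.re).le hcos
    simp [cosh_re]; linarith
  rw [h.deriv_E_eq, norm_mul, norm_mul, Complex.norm_ofNat]
  have h6 := mul_le_mul h3 h4 (by positivity) (norm_nonneg _)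
  linarith

lemma le_im_deriv_E_wApprox {ρ : ℝ} (hρ : 0 < ρ) (k : ℕ) :
    4 * (k * Real.pi * ρ * Real.cosh (Real.arsinh (k * Real.pi * ρ))) ≤
      (deriv (E ρ) (wApprox ρ k)).im := by
  have h : 0 ≤ Real.arsinh (k * Real.pi * ρ) :=
    Real.arsinh_nonneg_iff.2 (by have := Real.pi_pos; positivity)
  have h' : 0 ≤ ρ ^ 2 * Real.arsinh (k * Real.pi * ρ) := by positivity
  rw [deriv_E_wApprox]
  simp only [Complex.mul_im, Complex.add_im, Complex.add_re, Complex.ofReal_re, Complex.ofReal_im,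
    Complex.I_re, Complex.I_im, Complex.re_ofNat, Complex.im_ofNat, Complex.mul_re]
  linarith

lemma le_norm_deriv_E_wApprox {ρ : ℝ} (hρ : 0 < ρ) (k : ℕ) :
    4 * ρ ^ 2 * k ^ 2 ≤ ‖deriv (E ρ) (wApprox ρ k)‖ := by
  refine le_trans ?_ ((le_im_deriv_E_wApprox hρ k).trans
    ((le_abs_self _).trans (Complex.abs_im_le_norm _)))
  have hb : k * ρ ≤ k * Real.pi * ρ := by
    have : (k : ℝ) * 1 ≤ k * Real.pi := by gcongr; linarith [Real.pi_gt_three]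
    nlinarith
  have hc : k * Real.pi * ρ ≤ Real.cosh (Real.arsinh (k * Real.pi * ρ)) := by
    have := Real.sinh_lt_cosh (Real.arsinh (k * Real.pi * ρ))
    rw [Real.sinh_arsinh] at this; exact this.le
  have h0 : 0 ≤ k * ρ := by positivity
  nlinarith [mul_le_mul hb (hb.trans hc) h0 (h0.trans hb)]

lemma summable_norm_one_div_of_le {ρ : ℝ} (hρ : 0 < ρ) {d : ℕ → ℂ}
    (hd : ∀ k : ℕ, 1 ≤ k → 4 * ρ ^ 2 * k ^ 2 ≤ ‖d k‖) :
    Summable fun k : ℕ => ‖1 / d (k + 1)‖ := by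
  have h1 : Summable fun k : ℕ => 1 / (4 * ρ ^ 2) * (1 / ((k + 1 : ℕ) : ℝ) ^ 2) :=
    ((summable_nat_add_iff 1).2 (Real.summable_one_div_nat_pow.2 one_lt_two)).mul_left _
  refine Summable.of_nonneg_of_le (fun _ => norm_nonneg _) (fun k => ?_) h1
  rw [norm_div, norm_one, one_div_mul_one_div]
  exact one_div_le_one_div_of_le (by positivity) (hd (k + 1) (by omega))

lemma ne_zero_of_le_norm {ρ : ℝ} (hρ : 0 < ρ) {k : ℕ} (hk : 1 ≤ k) {d : ℂ}
    (hd : 4 * ρ ^ 2 * k ^ 2 ≤ ‖d‖) : d ≠ 0 := by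
  have hk' : (0 : ℝ) < k := by exact_mod_cast hk
  exact norm_pos_iff.1 (lt_of_lt_of_le (by positivity) hd)

lemma summable_norm_zTerm {ρ : ℝ} (hρ : 0 < ρ) : Summable fun k : ℕ => ‖zTerm ρ (k + 1)‖ :=
  summable_norm_one_div_of_le hρ (d := fun k => deriv (E ρ) (zRoot ρ k)) fun k hk => by
    obtain ⟨w, hw, h, -⟩ := exists_zRoot_eq hρ hk
    simpa only [h] using hw.le_norm_deriv_E hρ hk

lemma summable_norm_wTerm {ρ : ℝ} (hρ : 0 < ρ) : Summable fun k : ℕ => ‖wTerm ρ (k + 1)‖ :=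
  summable_norm_one_div_of_le hρ (d := fun k => deriv (E ρ) (wApprox ρ k)) fun k _ =>
    le_norm_deriv_E_wApprox hρ k

/-! ### Comparison of the two series -/

/-- The reduced root is of size `O(kπρ)`: its real part is at most `2 kπρ` because
`sinh y cos s ≤ kπρ` with `cos s ≥ 1 / 2`, and its imaginary part is even smaller because
`sin s = ρ y / cosh y`. -/
lemma IsReducedRoot.norm_le {ρ : ℝ} (hρ : 0 < ρ) (hρ' : ρ ≤ 1 / 2) {k : ℕ} {w : ℂ}
    (h : IsReducedRoot ρ k w) : ‖w‖ ≤ 4 * (k * Real.pi * ρ) := by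
  have hpi := Real.pi_pos
  have hpi4 := Real.pi_lt_four
  obtain ⟨hre, him, him2, -⟩ := id h
  have hy : w.re ≤ Real.sinh w.re := Real.self_le_sinh_iff.2 hre.le
  have hsin : Real.sin w.im ≤ ρ * w.re := by
    have := h.cosh_mul_sin
    have h0 : 0 ≤ Real.sin w.im := Real.sin_nonneg_of_nonneg_of_le_pi him (by linarith)
    nlinarith [Real.one_le_cosh w.re]
  have hsin1 : Real.sin w.im ≤ ρ := by
    have := h.cosh_mul_sin
    have h1 := Real.sinh_lt_cosh w.re
    have h2 : Real.cosh w.re * Real.sin w.im ≤ Real.cosh w.re * ρ := by nlinarith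
    exact le_of_mul_le_mul_left h2 (Real.cosh_pos _)
  have hjordan : w.im ≤ 2 * Real.sin w.im := by
    have h1 := Real.mul_le_sin him him2
    rw [div_mul_eq_mul_div, div_le_iff₀ hpi] at h1
    have h0 : 0 ≤ Real.sin w.im := Real.sin_nonneg_of_nonneg_of_le_pi him (by linarith)
    nlinarith
  have hcos : 1 / 2 ≤ Real.cos w.im := by
    rw [← Real.cos_pi_div_three]
    exact Real.cos_le_cos_of_nonneg_of_le_pi him (by linarith)
      (by linarith [Real.pi_gt_three])
  have h1 := h.sinh_mul_cos
  have h2 : Real.sinh w.re * (1 / 2) ≤ Real.sinh w.re * Real.cos w.im :=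
    mul_le_mul_of_nonneg_left hcos (by linarith)
  have h3 : w.re ≤ 2 * (k * Real.pi * ρ) := by nlinarith [mul_nonneg hρ.le him]
  have h4 : w.im ≤ w.re := by nlinarith
  have h5 := Complex.norm_le_abs_re_add_abs_im w
  rw [abs_of_pos hre, abs_of_nonneg him] at h5
  linarith

/-- With `b = kπρ` and `c = cosh (arsinh b)`, both derivatives are within `O(ρ b c)` of the common
main term `4 i b c`. The estimate for `cosh w - c` comes from
`cosh² w - c² = sinh² w - b²`. -/
lemma norm_deriv_E_sub_le {ρ : ℝ} (hρ : 0 < ρ) (hρ' : ρ ≤ 1 / 104) {k : ℕ} (hk : 1 ≤ k) {w : ℂ}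
    (h : IsReducedRoot ρ k w) :
    ‖deriv (E ρ) (wApprox ρ k) - deriv (E ρ) (stripPoint k w)‖ ≤
      56 * ρ * ‖deriv (E ρ) (stripPoint k w)‖ := by
  set b : ℝ := k * Real.pi * ρ with hb
  set c : ℝ := Real.cosh (Real.arsinh b) with hc
  have hb0 : 0 < b := by
    have hk' : (0 : ℝ) < k := by exact_mod_cast hk
    have := Real.pi_pos; positivity
  have hc1 : 1 ≤ c := Real.one_le_cosh _
  have hcsq : c ^ 2 = b ^ 2 + 1 := by rw [hc, Real.cosh_sq, Real.sinh_arsinh]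
  have hbc : b ≤ c := by nlinarith
  have hbbc : b ≤ b * c := le_mul_of_one_le_right hb0.le hc1
  set X := Complex.sinh w with hX
  set Y := Complex.cosh w with hY
  have hXb : ‖X - b‖ ≤ 4 * ρ * b := by
    have : X - b = ρ * Complex.I * w := by rw [hX, h.2.2.2, hb]; push_cast; ring
    rw [this, norm_mul, norm_mul, Complex.norm_I, Complex.norm_of_nonneg hρ.le]
    nlinarith [h.norm_le hρ (by linarith)]
  have hXn : ‖X‖ ≤ 2 * b := by
    have := norm_add_le (X - b) (b : ℂ)
    rw [sub_add_cancel, Complex.norm_of_nonneg hb0.le] at this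
    nlinarith
  have hYc : ‖Y - c‖ ≤ 12 * ρ * c := by
    have e1 : (Y - c) * (Y + c) = (X - b) * (X + b) := by
      have h1 := Complex.cosh_sq w
      have h2 : (c : ℂ) ^ 2 = (b : ℂ) ^ 2 + 1 := by exact_mod_cast hcsq
      linear_combination h1 - h2
    have e2 : c ≤ ‖Y + c‖ := by
      refine le_trans ?_ ((le_abs_self _).trans (Complex.abs_re_le_norm _))
      rw [Complex.add_re, cosh_re, Complex.ofReal_re]
      have := mul_nonneg (Real.cosh_pos w.re).le
        (Real.cos_nonneg_of_mem_Icc ⟨by linarith [h.2.1, Real.pi_pos], h.2.2.1⟩)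
      linarith
    have e3 : ‖X + b‖ ≤ 3 * b := by
      have := norm_add_le X (b : ℂ)
      rw [Complex.norm_of_nonneg hb0.le] at this
      linarith
    have e4 := congrArg norm e1
    rw [norm_mul, norm_mul] at e4
    have e5 : ‖X - b‖ * ‖X + b‖ ≤ 4 * ρ * b * (3 * b) := by gcongr
    have e6 : ‖Y - c‖ * c ≤ ‖Y - c‖ * ‖Y + c‖ := by gcongr
    have e7 : b * b ≤ c * c := by gcongr
    have e8 : ‖Y - c‖ * c ≤ 12 * ρ * c * c := by nlinarith
    exact le_of_mul_le_mul_right e8 (by linarith)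
  have hYn : ‖Y‖ ≤ 3 * c := by
    have := norm_add_le (Y - c) (c : ℂ)
    rw [sub_add_cancel, Complex.norm_of_nonneg (by linarith : 0 ≤ c)] at this
    nlinarith
  have hz : ‖deriv (E ρ) (stripPoint k w) - 4 * Complex.I * b * c‖ ≤ 104 * ρ * (b * c) := by
    have e1 : deriv (E ρ) (stripPoint k w) - 4 * Complex.I * b * c
        = 4 * (ρ * X + (Complex.I * ((X - b) * Y) + Complex.I * (b * (Y - c)))) := by
      rw [h.deriv_E_eq]; ring
    have e2 : ‖(ρ * X : ℂ)‖ ≤ ρ * (2 * b) := by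
      rw [norm_mul, Complex.norm_of_nonneg hρ.le]; gcongr
    have e3 : ‖Complex.I * ((X - b) * Y)‖ ≤ 4 * ρ * b * (3 * c) := by
      rw [norm_mul, norm_mul, Complex.norm_I, one_mul]; gcongr
    have e4 : ‖Complex.I * (b * (Y - c))‖ ≤ b * (12 * ρ * c) := by
      rw [norm_mul, norm_mul, Complex.norm_I, one_mul, Complex.norm_of_nonneg hb0.le]; gcongr
    rw [e1, norm_mul, Complex.norm_ofNat]
    have e5 := norm_add_le (ρ * X : ℂ) (Complex.I * ((X - b) * Y) + Complex.I * (b * (Y - c)))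
    have e6 := norm_add_le (Complex.I * ((X - b) * Y)) (Complex.I * (b * (Y - c)))
    nlinarith
  have hw : ‖deriv (E ρ) (wApprox ρ k) - 4 * Complex.I * b * c‖ ≤ 8 * ρ * (b * c) := by
    have e1 : deriv (E ρ) (wApprox ρ k) - 4 * Complex.I * b * c
        = 4 * (ρ * b + Complex.I * (ρ ^ 2 * Real.arsinh b)) := by
      rw [deriv_E_wApprox, ← hb, ← hc]; push_cast; ring
    have e2 : Real.arsinh b ≤ b := by
      have := (Real.self_le_sinh_iff (x := Real.arsinh b)).2 (Real.arsinh_nonneg_iff.2 hb0.le)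
      rwa [Real.sinh_arsinh] at this
    have e3 : ‖(ρ * b : ℂ)‖ ≤ ρ * b := by
      rw [norm_mul, Complex.norm_of_nonneg hρ.le, Complex.norm_of_nonneg hb0.le]
    have e4 : ‖Complex.I * (ρ ^ 2 * Real.arsinh b)‖ ≤ ρ ^ 2 * b := by
      rw [norm_mul, norm_mul, norm_pow, Complex.norm_I, one_mul, Complex.norm_of_nonneg hρ.le,
        Complex.norm_of_nonneg (Real.arsinh_nonneg_iff.2 hb0.le)]
      gcongr
    rw [e1, norm_mul, Complex.norm_ofNat]
    have e5 := norm_add_le (ρ * b : ℂ) (Complex.I * (ρ ^ 2 * Real.arsinh b))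
    have e6 : ρ ^ 2 * b ≤ ρ * b := by nlinarith [mul_pos hρ hb0]
    nlinarith
  have hmain : ‖(4 * Complex.I * b * c : ℂ)‖ = 4 * (b * c) := by
    rw [norm_mul, norm_mul, norm_mul, Complex.norm_I, Complex.norm_ofNat,
      Complex.norm_of_nonneg hb0.le, Complex.norm_of_nonneg (by linarith : 0 ≤ c)]
    ring
  have hbc0 : 0 < b * c := by positivity
  have hlow : 2 * (b * c) ≤ ‖deriv (E ρ) (stripPoint k w)‖ := by
    have := norm_sub_norm_le (4 * Complex.I * b * c : ℂ) (deriv (E ρ) (stripPoint k w))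
    rw [hmain, norm_sub_rev] at this
    nlinarith
  have htri := norm_sub_le_norm_sub_add_norm_sub (deriv (E ρ) (wApprox ρ k))
    (4 * Complex.I * b * c) (deriv (E ρ) (stripPoint k w))
  rw [norm_sub_rev (4 * Complex.I * b * c)] at htri
  nlinarith

lemma exists_zTerm_eq {ρ : ℝ} (hρ : 0 < ρ) (hρ' : ρ ≤ 1 / 104) {k : ℕ} (hk : 1 ≤ k) :
    ∃ η : ℂ, ‖η‖ ≤ 56 * ρ ∧ zTerm ρ k = (1 + η) * wTerm ρ k := by
  obtain ⟨w, hw, hz, -⟩ := exists_zRoot_eq hρ hk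
  have h1 := ne_zero_of_le_norm hρ hk (hw.le_norm_deriv_E hρ hk)
  have h2 := ne_zero_of_le_norm hρ hk (le_norm_deriv_E_wApprox hρ k)
  refine ⟨(deriv (E ρ) (wApprox ρ k) - deriv (E ρ) (stripPoint k w)) /
    deriv (E ρ) (stripPoint k w), ?_, ?_⟩
  · rw [norm_div, div_le_iff₀ (norm_pos_iff.2 h1)]
    exact norm_deriv_E_sub_le hρ hρ' hk hw
  · rw [zTerm, wTerm, hz]
    field_simp
    ring

/-- The terms of `J̃` all lie in a fixed sector around the negative imaginary axis. -/
lemma norm_wTerm_le {ρ : ℝ} (hρ : 0 < ρ) (hρ' : ρ ≤ 1) {k : ℕ} (hk : 1 ≤ k) :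
    ‖wTerm ρ k‖ ≤ 2 * -(wTerm ρ k).im := by
  have h2 := ne_zero_of_le_norm hρ hk (le_norm_deriv_E_wApprox hρ k)
  have him := le_im_deriv_E_wApprox hρ k
  have hb0 : 0 ≤ k * Real.pi * ρ := by have := Real.pi_pos; positivity
  have hre : (deriv (E ρ) (wApprox ρ k)).re = 4 * (ρ * (k * Real.pi * ρ)) := by
    rw [deriv_E_wApprox]
    simp only [Complex.mul_im, Complex.add_im, Complex.add_re, Complex.ofReal_re,
      Complex.ofReal_im, Complex.I_re, Complex.I_im, Complex.re_ofNat, Complex.im_ofNat,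
      Complex.mul_re]
    ring
  set d := deriv (E ρ) (wApprox ρ k) with hd
  have hle : ‖d‖ ≤ 2 * d.im := by
    have h3 := Complex.norm_le_abs_re_add_abs_im d
    have h4 : ρ * (k * Real.pi * ρ) ≤ 1 * (k * Real.pi * ρ) := by gcongr
    have h5 : k * Real.pi * ρ * 1 ≤
        k * Real.pi * ρ * Real.cosh (Real.arsinh (k * Real.pi * ρ)) := by
      gcongr; exact Real.one_le_cosh _
    rw [abs_of_nonneg (by rw [hre]; positivity), abs_of_nonneg (by linarith), hre] at h3
    linarith
  have hn : 0 < ‖d‖ := norm_pos_iff.2 h2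
  rw [wTerm, ← hd, norm_div, norm_one, one_div, one_div, Complex.inv_im, Complex.normSq_eq_norm_sq,
    neg_div, neg_neg, ← mul_div_assoc, le_div_iff₀ (by positivity)]
  have : ‖d‖⁻¹ * ‖d‖ ^ 2 = ‖d‖ := by field_simp
  linarith

lemma norm_JTilde_ge {ρ : ℝ} (hρ : 0 < ρ) (hρ' : ρ ≤ 1) :
    ∑' k : ℕ, ‖wTerm ρ (k + 1)‖ ≤ 2 * ‖JTilde ρ‖ := by
  have hs := summable_norm_wTerm hρ
  have him : HasSum (fun k : ℕ => (wTerm ρ (k + 1)).im) (JTilde ρ).im :=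
    Complex.hasSum_im hs.of_norm.hasSum
  have h1 : HasSum (fun k : ℕ => 2 * -(wTerm ρ (k + 1)).im) (2 * -(JTilde ρ).im) :=
    him.neg.mul_left 2
  have h2 := hasSum_le (fun k : ℕ => norm_wTerm_le hρ hρ' (k := k + 1) (by omega)) hs.hasSum h1
  linarith [Complex.abs_im_le_norm (JTilde ρ), neg_abs_le (JTilde ρ).im]

lemma norm_J_sub_JTilde_le {ρ : ℝ} (hρ : 0 < ρ) (hρ' : ρ ≤ 1 / 104) :
    ‖J ρ - JTilde ρ‖ ≤ 56 * ρ * ∑' k : ℕ, ‖wTerm ρ (k + 1)‖ := by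
  have hw := summable_norm_wTerm hρ
  rw [J, JTilde, ← (summable_norm_zTerm hρ).of_norm.tsum_sub hw.of_norm]
  refine tsum_of_norm_bounded (hw.hasSum.mul_left (56 * ρ)) fun k => ?_
  obtain ⟨η, h1, h2⟩ := exists_zTerm_eq hρ hρ' (k := k + 1) (by omega)
  rw [h2, show (1 + η) * wTerm ρ (k + 1) - wTerm ρ (k + 1) = η * wTerm ρ (k + 1) by ring, norm_mul]
  gcongr

lemma asympEquivAtZero_J_JTilde : AsympEquivAtZero J JTilde := by
  intro ε hε
  refine ⟨min (1 / 104) (ε / 224), by positivity, fun ρ hρ hlt => ?_⟩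
  have hρ1 : ρ < 1 / 104 := hlt.trans_le (min_le_left _ _)
  have hρ2 : ρ < ε / 224 := hlt.trans_le (min_le_right _ _)
  have hpos : 0 < ∑' k : ℕ, ‖wTerm ρ (k + 1)‖ := by
    refine (summable_norm_wTerm hρ).tsum_pos (fun _ => norm_nonneg _) 0 (norm_pos_iff.2 ?_)
    exact one_div_ne_zero (ne_zero_of_le_norm hρ le_rfl (le_norm_deriv_E_wApprox hρ 1))
  have h1 := norm_J_sub_JTilde_le hρ hρ1.le
  have h2 := norm_JTilde_ge hρ (by linarith)
  nlinarith

/-! ### Pointwise bounds for the energy density -/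

lemma sin_half_sq_le (t : ℝ) : 4 * Real.sin (t / 2) ^ 2 ≤ t ^ 2 := by
  have := sq_le_sq.2 (Real.abs_sin_le_abs (x := t / 2))
  linarith [show (t / 2) ^ 2 = t ^ 2 / 4 by ring]

lemma sq_sub_sin_half_sq_le (t : ℝ) : t ^ 2 - 4 * Real.sin (t / 2) ^ 2 ≤ t ^ 4 / 12 := by
  have key : ∀ x : ℝ, 0 ≤ x → x ^ 2 - Real.sin x ^ 2 ≤ x ^ 4 / 3 := by
    intro x hx
    rcases hx.eq_or_lt with rfl | hx
    · simp
    have h1 := Real.sin_gt_sub_cube hx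
    have h2 := Real.sin_le hx.le
    have h3 := (abs_le.1 (Real.abs_sin_le_abs (x := x))).1
    rw [abs_of_pos hx] at h3
    have h4 : (x - Real.sin x) * (x + Real.sin x) ≤ x ^ 3 / 6 * (2 * x) := by
      gcongr <;> linarith
    nlinarith
  have h := key |t / 2| (abs_nonneg _)
  have h4 : Real.sin |t / 2| ^ 2 = Real.sin (t / 2) ^ 2 := by
    rcases abs_cases (t / 2) with h | h <;> simp [h.1]
  rw [sq_abs, h4, show |t / 2| ^ 4 = (t / 2) ^ 4 from (by decide : Even 4).pow_abs _] at h
  linarith [show (t / 2) ^ 2 = t ^ 2 / 4 by ring, show (t / 2) ^ 4 = t ^ 4 / 16 by ring]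

lemma sq_div_four_le_sin_half_sq {t : ℝ} (ht : |t| ≤ Real.pi) :
    t ^ 2 / 4 ≤ 4 * Real.sin (t / 2) ^ 2 := by
  have hpi := Real.pi_pos
  have h2 : |t / 2| = |t| / 2 := by rw [abs_div, abs_two]
  have h := Real.mul_abs_le_abs_sin (x := t / 2) (by rw [h2]; linarith)
  have h1 : 1 / 2 * |t / 2| ≤ |Real.sin (t / 2)| := by
    refine le_trans (mul_le_mul_of_nonneg_right ?_ (abs_nonneg _)) h
    rw [div_le_div_iff₀ two_pos hpi]
    linarith [Real.pi_lt_four]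
  have h3 := pow_le_pow_left₀ (by positivity) h1 2
  rw [mul_pow, sq_abs, sq_abs] at h3
  linarith [show (t / 2) ^ 2 = t ^ 2 / 4 by ring]

lemma denom_pos {ρ t : ℝ} (hρ : 0 < ρ) (ht : t ≠ 0) :
    0 < ρ ^ 2 * t ^ 2 + 4 * Real.sin (t / 2) ^ 2 := by positivity

lemma M_zero (ρ : ℝ) : M ρ 0 = 0 := by simp [M]

lemma M_eq {ρ t : ℝ} (hρ : 0 < ρ) (ht : t ≠ 0) :
    M ρ t = (t ^ 2 - 4 * Real.sin (t / 2) ^ 2) /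
      (t ^ 2 * (ρ ^ 2 * t ^ 2 + 4 * Real.sin (t / 2) ^ 2)) := by
  have := (denom_pos hρ ht).ne'
  rw [M]
  field_simp
  ring

lemma M_nonneg {ρ : ℝ} (hρ : 0 < ρ) (t : ℝ) : 0 ≤ M ρ t := by
  rcases eq_or_ne t 0 with rfl | ht
  · rw [M_zero]
  rw [M_eq hρ ht]
  have := sin_half_sq_le t
  exact div_nonneg (by linarith) (by positivity)

lemma M_le_third {ρ t : ℝ} (hρ : 0 < ρ) (ht : |t| ≤ Real.pi) : M ρ t ≤ 1 / 3 := by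
  rcases eq_or_ne t 0 with rfl | h0
  · rw [M_zero]; norm_num
  have h1 := sq_sub_sin_half_sq_le t
  have h2 := sq_div_four_le_sin_half_sq ht
  have h3 := denom_pos hρ h0
  rw [M_eq hρ h0, div_le_iff₀ (by positivity)]
  have h4 : t ^ 2 * (t ^ 2 / 4) ≤ t ^ 2 * (ρ ^ 2 * t ^ 2 + 4 * Real.sin (t / 2) ^ 2) := by
    gcongr; nlinarith [sq_nonneg (ρ * t)]
  nlinarith

lemma M_le {ρ t : ℝ} (hρ : 0 < ρ) (ht : t ≠ 0) :
    M ρ t ≤ 1 / (ρ ^ 2 * t ^ 2 + 4 * Real.sin (t / 2) ^ 2) := by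
  have h := denom_pos hρ ht
  have h1 : ρ ^ 2 / (ρ ^ 2 * t ^ 2 + 4 * Real.sin (t / 2) ^ 2) ≤ 1 / t ^ 2 := by
    rw [div_le_div_iff₀ h (by positivity)]
    nlinarith [sq_nonneg (Real.sin (t / 2))]
  rw [M, add_div]
  linarith

lemma le_M {ρ t : ℝ} (hρ : 0 < ρ) (ht : t ≠ 0) :
    1 / (ρ ^ 2 * t ^ 2 + 4 * Real.sin (t / 2) ^ 2) - 1 / t ^ 2 ≤ M ρ t := by
  have h := denom_pos hρ ht
  have h1 : 0 ≤ ρ ^ 2 / (ρ ^ 2 * t ^ 2 + 4 * Real.sin (t / 2) ^ 2) := by positivity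
  rw [M, add_div]
  linarith

lemma M_le_one_div_sq {ρ t : ℝ} (hρ : 0 < ρ) (ht : t ≠ 0) : M ρ t ≤ 1 / (ρ ^ 2 * t ^ 2) := by
  refine (M_le hρ ht).trans (one_div_le_one_div_of_le (by positivity) ?_)
  linarith [sq_nonneg (Real.sin (t / 2))]

lemma integrable_M {ρ : ℝ} (hρ : 0 < ρ) : Integrable (M ρ) := by
  refine Integrable.mono' (integrable_inv_one_add_sq.const_mul (6 + 2 / ρ ^ 2))
    (Measurable.aestronglyMeasurable (by unfold M; fun_prop)) (Filter.Eventually.of_forall ?_)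
  intro t
  rw [Real.norm_of_nonneg (M_nonneg hρ t), ← div_eq_mul_inv, le_div_iff₀ (by positivity)]
  have hρ2 : 0 < 2 / ρ ^ 2 := by positivity
  rcases le_or_gt |t| Real.pi with h | h
  · have h1 := M_le_third hρ h
    have h2 : t ^ 2 ≤ 16 := by
      rw [← sq_abs]
      nlinarith [abs_nonneg t, Real.pi_lt_four]
    nlinarith [M_nonneg hρ t]
  · have h1 : 1 ≤ t ^ 2 := by
      rw [← sq_abs]
      nlinarith [Real.pi_gt_three]
    have h0 : t ≠ 0 := by rintro rfl; norm_num at h1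
    have h2 : M ρ t * (1 + t ^ 2) ≤ 1 / (ρ ^ 2 * t ^ 2) * (2 * t ^ 2) :=
      mul_le_mul (M_le_one_div_sq hρ h0) (by linarith) (by positivity) (by positivity)
    have h3 : 1 / (ρ ^ 2 * t ^ 2) * (2 * t ^ 2) = 2 / ρ ^ 2 := by field_simp
    linarith

/-! ### Asymptotics of the energy integral -/

lemma integral_one_div_sq_add_sq {c : ℝ} (hc : 0 < c) :
    ∫ u in (-Real.pi)..Real.pi, 1 / (c ^ 2 + u ^ 2) = 2 * Real.arctan (Real.pi / c) / c := by
  have h : ∀ u : ℝ, 1 / (c ^ 2 + u ^ 2) = 1 / c ^ 2 * (1 + (u / c) ^ 2)⁻¹ := fun u => by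
    field_simp
  simp_rw [h]
  rw [intervalIntegral.integral_const_mul,
    intervalIntegral.integral_comp_div (fun x : ℝ => (1 + x ^ 2)⁻¹) hc.ne',
    integral_inv_one_add_sq, neg_div, Real.arctan_neg, smul_eq_mul]
  field_simp
  ring

lemma integral_one_div_sq_add_sq_le {c : ℝ} (hc : 0 < c) :
    ∫ u in (-Real.pi)..Real.pi, 1 / (c ^ 2 + u ^ 2) ≤ Real.pi / c := by
  rw [integral_one_div_sq_add_sq hc]
  gcongr
  linarith [Real.arctan_lt_pi_div_two (Real.pi / c)]

lemma le_integral_one_div_sq_add_sq {c : ℝ} (hc : 0 < c) :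
    Real.pi / c - 1 ≤ ∫ u in (-Real.pi)..Real.pi, 1 / (c ^ 2 + u ^ 2) := by
  have hpi := Real.pi_pos
  rw [integral_one_div_sq_add_sq hc, le_div_iff₀ hc, sub_mul, div_mul_cancel₀ _ hc.ne']
  have h1 := Real.arctan_inv_of_pos (show 0 < c / Real.pi by positivity)
  rw [inv_div] at h1
  have h2 : Real.arctan (c / Real.pi) ≤ c / Real.pi := by
    have h := Real.le_tan (Real.arctan_nonneg.2 (show 0 ≤ c / Real.pi by positivity))
      (Real.arctan_lt_pi_div_two _)
    rwa [Real.tan_arctan] at h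
  have h3 : c / Real.pi ≤ c / 2 := by gcongr; exact Real.two_le_pi
  rw [h1]
  linarith

lemma sin_half_add_nat_mul_two_pi_sq (k : ℕ) (u : ℝ) :
    Real.sin ((2 * k * Real.pi + u) / 2) ^ 2 = Real.sin (u / 2) ^ 2 := by
  rw [show (2 * k * Real.pi + u) / 2 = u / 2 + k * Real.pi by ring, Real.sin_add_nat_mul_pi,
    mul_pow, ← pow_mul, mul_comm k, pow_mul]
  norm_num

/-- Near `2kπ` the integrand is at most a Cauchy density up to a bounded error, which does not
depend on the height of the peak. -/
lemma M_add_le {ρ : ℝ} (hρ : 0 < ρ) {k : ℕ} (hk : 1 ≤ k) {u : ℝ} (hu : |u| ≤ Real.pi) :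
    M ρ (2 * k * Real.pi + u) ≤
      1 / ((ρ * ((2 * k - 1) * Real.pi)) ^ 2 + u ^ 2) + 1 / 3 := by
  have hpi := Real.pi_pos
  have hk' : (1 : ℝ) ≤ k := by exact_mod_cast hk
  have hu' := abs_le.1 hu
  have ht : (2 * k - 1) * Real.pi ≤ 2 * k * Real.pi + u := by linarith
  have hc' : 0 < (2 * (k : ℝ) - 1) * Real.pi := mul_pos (by linarith) hpi
  refine (M_le hρ (by linarith : 0 < 2 * k * Real.pi + u).ne').trans ?_
  rw [sin_half_add_nat_mul_two_pi_sq, ← mul_pow]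
  set c := ρ * ((2 * k - 1) * Real.pi) with hc
  have hc0 : 0 < c := by positivity
  have h1 : 1 / ((ρ * (2 * k * Real.pi + u)) ^ 2 + 4 * Real.sin (u / 2) ^ 2) ≤
      1 / (c ^ 2 + 4 * Real.sin (u / 2) ^ 2) := by
    rw [hc]; gcongr
  refine h1.trans ?_
  have h2 := sq_sub_sin_half_sq_le u
  have h3 := sq_div_four_le_sin_half_sq hu
  have hd : 0 < c ^ 2 + 4 * Real.sin (u / 2) ^ 2 := by positivity
  have hd' : 0 < c ^ 2 + u ^ 2 := by positivity
  have h4 : 1 / (c ^ 2 + 4 * Real.sin (u / 2) ^ 2) - 1 / (c ^ 2 + u ^ 2) ≤ 1 / 3 := by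
    rw [div_sub_div _ _ hd.ne' hd'.ne', div_le_iff₀ (by positivity)]
    have h5 : u ^ 2 / 4 * u ^ 2 ≤ (c ^ 2 + 4 * Real.sin (u / 2) ^ 2) * (c ^ 2 + u ^ 2) := by
      gcongr
      · linarith [sq_nonneg c]
      · linarith [sq_nonneg c]
    nlinarith
  linarith

lemma le_M_add {ρ : ℝ} (hρ : 0 < ρ) {k : ℕ} (hk : 1 ≤ k) {u : ℝ} (hu : |u| ≤ Real.pi) :
    1 / ((ρ * ((2 * k + 1) * Real.pi)) ^ 2 + u ^ 2) - 1 ≤ M ρ (2 * k * Real.pi + u) := by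
  have hpi := Real.pi_gt_three
  have hk' : (1 : ℝ) ≤ k := by exact_mod_cast hk
  have hu' := abs_le.1 hu
  have ht : 1 ≤ 2 * k * Real.pi + u := by nlinarith
  refine le_trans ?_ (le_M hρ (by linarith : 0 < 2 * k * Real.pi + u).ne')
  have h1 : 1 / (2 * k * Real.pi + u) ^ 2 ≤ 1 := by
    rw [div_le_one (by positivity)]; nlinarith
  have h2 := denom_pos hρ (by linarith : 0 < 2 * k * Real.pi + u).ne'
  refine sub_le_sub (one_div_le_one_div_of_le h2 ?_) h1
  rw [sin_half_add_nat_mul_two_pi_sq, ← mul_pow]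
  gcongr
  · linarith
  · exact sin_half_sq_le u

lemma intervalIntegrable_one_div_sq_add_sq {c : ℝ} (hc : 0 < c) (a b : ℝ) :
    IntervalIntegrable (fun u : ℝ => 1 / (c ^ 2 + u ^ 2)) volume a b := by
  refine Continuous.intervalIntegrable (continuous_const.div (by fun_prop) fun u => ?_) a b
  positivity

lemma integral_M_period_eq (ρ : ℝ) (k : ℕ) :
    ∫ t in ((2 * k - 1) * Real.pi)..((2 * k + 1) * Real.pi), M ρ t =
      ∫ u in (-Real.pi)..Real.pi, M ρ (2 * k * Real.pi + u) := by
  rw [intervalIntegral.integral_comp_add_left (M ρ)]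
  congr 1 <;> ring

lemma intervalIntegrable_M_add {ρ : ℝ} (hρ : 0 < ρ) (d a b : ℝ) :
    IntervalIntegrable (fun u => M ρ (d + u)) volume a b :=
  ((integrable_M hρ).comp_add_left d).intervalIntegrable

lemma integral_M_period_le {ρ : ℝ} (hρ : 0 < ρ) {k : ℕ} (hk : 1 ≤ k) :
    ∫ t in ((2 * k - 1) * Real.pi)..((2 * k + 1) * Real.pi), M ρ t ≤
      1 / ρ * (1 / (2 * k - 1)) + 3 := by
  have hpi := Real.pi_pos
  have hk' : (1 : ℝ) ≤ k := by exact_mod_cast hk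
  have h1 : 0 < 2 * (k : ℝ) - 1 := by linarith
  have hc0 : 0 < ρ * ((2 * k - 1) * Real.pi) := by positivity
  have h := intervalIntegral.integral_mono_on (by linarith : -Real.pi ≤ Real.pi)
    (intervalIntegrable_M_add hρ (2 * k * Real.pi) _ _)
    ((intervalIntegrable_one_div_sq_add_sq hc0 _ _).add
      (intervalIntegrable_const (c := (1 / 3 : ℝ))))
    fun u hu => M_add_le hρ hk (abs_le.2 hu)
  rw [intervalIntegral.integral_add (intervalIntegrable_one_div_sq_add_sq hc0 _ _)
    intervalIntegrable_const, intervalIntegral.integral_const, smul_eq_mul] at h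
  have h2 := integral_one_div_sq_add_sq_le hc0
  have h3 : Real.pi / (ρ * ((2 * k - 1) * Real.pi)) = 1 / ρ * (1 / (2 * k - 1)) := by
    field_simp
  rw [integral_M_period_eq, ← h3]
  linarith [Real.pi_lt_four]

lemma le_integral_M_period {ρ : ℝ} (hρ : 0 < ρ) {k : ℕ} (hk : 1 ≤ k) :
    1 / ρ * (1 / (2 * k + 1)) - 9 ≤
      ∫ t in ((2 * k - 1) * Real.pi)..((2 * k + 1) * Real.pi), M ρ t := by
  have hpi := Real.pi_pos
  have hc0 : 0 < ρ * ((2 * k + 1) * Real.pi) := by positivity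
  have h := intervalIntegral.integral_mono_on (by linarith : -Real.pi ≤ Real.pi)
    ((intervalIntegrable_one_div_sq_add_sq hc0 _ _).sub
      (intervalIntegrable_const (c := (1 : ℝ))))
    (intervalIntegrable_M_add hρ (2 * k * Real.pi) _ _)
    fun u hu => le_M_add hρ hk (abs_le.2 hu)
  rw [intervalIntegral.integral_sub (intervalIntegrable_one_div_sq_add_sq hc0 _ _)
    intervalIntegrable_const, intervalIntegral.integral_const, smul_eq_mul] at h
  have h2 := le_integral_one_div_sq_add_sq hc0
  have h3 : Real.pi / (ρ * ((2 * k + 1) * Real.pi)) = 1 / ρ * (1 / (2 * k + 1)) := by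
    field_simp
  rw [integral_M_period_eq, ← h3]
  linarith [Real.pi_lt_four]

lemma integral_M_eq_sum {ρ : ℝ} (hρ : 0 < ρ) (N : ℕ) :
    ∫ t in Real.pi..((2 * N + 1) * Real.pi), M ρ t =
      ∑ k ∈ Finset.range N, ∫ t in
        ((2 * ((k + 1 : ℕ) : ℝ) - 1) * Real.pi)..((2 * ((k + 1 : ℕ) : ℝ) + 1) * Real.pi), M ρ t := by
  have h := intervalIntegral.sum_integral_adjacent_intervals (f := M ρ) (μ := volume)
    (a := fun k : ℕ => (2 * (k : ℝ) + 1) * Real.pi) (n := N)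
    fun k _ => (integrable_M hρ).intervalIntegrable
  simp only [Nat.cast_zero, mul_zero, zero_add, one_mul] at h
  rw [← h]
  refine Finset.sum_congr rfl fun k _ => ?_
  congr 1
  push_cast; ring

lemma sum_one_div_odd_le (n : ℕ) :
    ∑ k ∈ Finset.range (n + 1), 1 / (2 * ((k + 1 : ℕ) : ℝ) - 1) ≤ 1 + (harmonic n : ℝ) / 2 := by
  induction n with
  | zero => norm_num
  | succ n ih =>
    rw [Finset.sum_range_succ, harmonic_succ]
    have h : 1 / (2 * ((n + 1 + 1 : ℕ) : ℝ) - 1) ≤ ((n + 1 : ℕ) : ℝ)⁻¹ / 2 := by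
      rw [← one_div, div_div]
      refine one_div_le_one_div_of_le (by positivity) ?_
      push_cast; linarith
    push_cast at h ih ⊢
    linarith

lemma le_sum_one_div_odd (n : ℕ) :
    ((harmonic (n + 1) : ℝ) - 1) / 2 ≤
      ∑ k ∈ Finset.range n, 1 / (2 * ((k + 1 : ℕ) : ℝ) + 1) := by
  induction n with
  | zero => norm_num [harmonic_succ]
  | succ n ih =>
    rw [Finset.sum_range_succ, harmonic_succ]
    have h : ((n + 1 + 1 : ℕ) : ℝ)⁻¹ / 2 ≤ 1 / (2 * ((n + 1 : ℕ) : ℝ) + 1) := by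
      rw [← one_div, div_div]
      refine one_div_le_one_div_of_le (by positivity) ?_
      push_cast; linarith
    push_cast at h ih ⊢
    linarith

lemma integral_M_Ioi_le {ρ T : ℝ} (hρ : 0 < ρ) (hT : 0 < T) :
    ∫ t in Set.Ioi T, M ρ t ≤ 1 / (ρ ^ 2 * T) := by
  have h : ∫ t in Set.Ioi T, M ρ t ≤ ∫ t in Set.Ioi T, 1 / ρ ^ 2 * t ^ (-2 : ℝ) := by
    refine setIntegral_mono_on (integrable_M hρ).integrableOn
      ((integrableOn_Ioi_rpow_of_lt (by norm_num) hT).const_mul _) measurableSet_Ioi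
      fun t ht => ?_
    have ht0 : 0 < t := hT.trans ht
    refine (M_le_one_div_sq hρ ht0.ne').trans (le_of_eq ?_)
    rw [Real.rpow_neg ht0.le, Real.rpow_two, ← one_div, one_div_mul_one_div]
  refine h.trans (le_of_eq ?_)
  rw [integral_const_mul, integral_Ioi_rpow_of_lt (by norm_num) hT,
    show (-2 : ℝ) + 1 = -1 by norm_num, Real.rpow_neg_one]
  field_simp

lemma I_eq_two_mul_add {ρ : ℝ} (hρ : 0 < ρ) (N : ℕ) :
    I ρ = 2 * ((∫ t in (0 : ℝ)..Real.pi, M ρ t) +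
      (∫ t in Real.pi..((2 * N + 1) * Real.pi), M ρ t) +
      ∫ t in Set.Ioi ((2 * N + 1) * Real.pi), M ρ t) := by
  have habs : ∀ t, M ρ |t| = M ρ t := fun t => by
    rcases abs_cases t with h | h <;> simp [h.1, M, neg_div]
  have hi := integrable_M hρ
  rw [intervalIntegral.integral_add_adjacent_intervals hi.intervalIntegrable hi.intervalIntegrable,
    intervalIntegral.integral_interval_add_Ioi hi.integrableOn hi.integrableOn,
    ← integral_comp_abs, I]
  simp_rw [habs]

/-- The half-line integral is cut at `(2 n + 3) π` with `n = ⌊1 / ρ⌋`. The peak at `2kπ` contributes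
about `1 / (2 k ρ)` up to a bounded error, for `k ≤ n + 1`; these errors, the part near `0` and the
tail are together `O(1 / ρ)`. -/
lemma abs_I_sub_le {ρ : ℝ} (hρ : 0 < ρ) (hρ' : ρ < 1) :
    |I ρ - Real.log (1 / ρ) / ρ| ≤ 40 / ρ := by
  have hpi := Real.pi_gt_three
  set R := 1 / ρ with hR
  have hR0 : 0 < R := by positivity
  have hR1 : 1 < R := by rw [hR, one_lt_div hρ]; exact hρ'
  set n := ⌊R⌋₊ with hn
  have hn1 : (n : ℝ) ≤ R := Nat.floor_le hR0.le
  have hn2 : R < n + 1 := Nat.lt_floor_add_one R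
  have hn0 : 1 ≤ n := Nat.le_floor (by simpa using hR1.le)
  have hn0' : (1 : ℝ) ≤ n := by exact_mod_cast hn0
  have hi := integrable_M hρ
  have hI := I_eq_two_mul_add hρ (n + 1)
  rw [integral_M_eq_sum hρ] at hI
  have hnear0 : 0 ≤ ∫ t in (0 : ℝ)..Real.pi, M ρ t :=
    intervalIntegral.integral_nonneg (by linarith) fun t _ => M_nonneg hρ t
  have hnear1 : ∫ t in (0 : ℝ)..Real.pi, M ρ t ≤ 2 := by
    have h := intervalIntegral.integral_mono_on (by linarith : 0 ≤ Real.pi)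
      hi.intervalIntegrable (intervalIntegrable_const (c := (1 / 3 : ℝ)))
      fun t ht => M_le_third hρ (abs_le.2 ⟨by linarith [ht.1], ht.2⟩)
    rw [intervalIntegral.integral_const, smul_eq_mul] at h
    linarith [Real.pi_lt_four]
  have htail0 : 0 ≤ ∫ t in Set.Ioi ((2 * ((n + 1 : ℕ) : ℝ) + 1) * Real.pi), M ρ t :=
    setIntegral_nonneg measurableSet_Ioi fun t _ => M_nonneg hρ t
  have htail1 : ∫ t in Set.Ioi ((2 * ((n + 1 : ℕ) : ℝ) + 1) * Real.pi), M ρ t ≤ R := by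
    refine (integral_M_Ioi_le hρ (by positivity)).trans ?_
    rw [hR]
    refine one_div_le_one_div_of_le hρ ?_
    have h1 : R ≤ (2 * ((n + 1 : ℕ) : ℝ) + 1) * Real.pi := by push_cast; nlinarith
    have h2 : ρ ^ 2 * R = ρ := by rw [hR]; field_simp
    nlinarith [mul_le_mul_of_nonneg_left h1 (sq_nonneg ρ)]
  have hup := Finset.sum_le_sum fun k (_ : k ∈ Finset.range (n + 1)) =>
    integral_M_period_le hρ (k := k + 1) (by omega)
  have hlow := Finset.sum_le_sum fun k (_ : k ∈ Finset.range (n + 1)) =>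
    le_integral_M_period hρ (k := k + 1) (by omega)
  rw [Finset.sum_add_distrib, ← Finset.mul_sum, Finset.sum_const, Finset.card_range, nsmul_eq_mul,
    ← hR] at hup
  rw [Finset.sum_sub_distrib, ← Finset.mul_sum, Finset.sum_const, Finset.card_range, nsmul_eq_mul,
    ← hR] at hlow
  have hup1 : R * ∑ k ∈ Finset.range (n + 1), 1 / (2 * ((k + 1 : ℕ) : ℝ) - 1) ≤
      R * (3 / 2 + Real.log R / 2) := by
    gcongr
    have h1 := sum_one_div_odd_le n
    have h2 := harmonic_le_one_add_log n
    have h3 := Real.log_le_log (by linarith) hn1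
    linarith
  have hlow1 : R * (Real.log R / 2 - 1 / 2) ≤
      R * ∑ k ∈ Finset.range (n + 1), 1 / (2 * ((k + 1 : ℕ) : ℝ) + 1) := by
    gcongr
    have h1 := le_sum_one_div_odd (n + 1)
    have h2 := log_add_one_le_harmonic (n + 1 + 1)
    have h3 := Real.log_le_log hR0 (show R ≤ ((n + 1 + 1 + 1 : ℕ) : ℝ) by push_cast; linarith)
    linarith
  rw [show Real.log R / ρ = R * Real.log R by rw [hR]; ring, show 40 / ρ = 40 * R by rw [hR]; ring,
    abs_le]
  push_cast at *
  constructor <;> nlinarith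

lemma asympEquivAtZero_I : AsympEquivAtZero I (fun ρ : ℝ => Real.log (1 / ρ) / ρ) := by
  intro ε hε
  refine ⟨min 1 (Real.exp (-(40 / ε))), by positivity, fun ρ hρ hlt => ?_⟩
  have h1 := abs_I_sub_le hρ (hlt.trans_le (min_le_left _ _))
  have h2 : Real.log ρ < -(40 / ε) :=
    (Real.log_lt_iff_lt_exp hρ).2 (hlt.trans_le (min_le_right _ _))
  have h3 : 40 / ε < Real.log (1 / ρ) := by rw [one_div, Real.log_inv]; linarith
  have h4 : 0 < 40 / ε := by positivity
  rw [Real.norm_eq_abs, Real.norm_of_nonneg (div_nonneg (by linarith) hρ.le)]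
  refine h1.trans_lt ?_
  rw [← mul_div_assoc]
  gcongr
  rwa [div_lt_iff₀' hε] at h3

end Helix

theorem proposition3p14 :
    -- for all `ρ > 0`, `k ≥ 1`: `z_k(ρ)` is the unique root in its half-strip,
    -- and the derivatives whose reciprocals are summed do not vanish
    (∀ ρ : ℝ, 0 < ρ → ∀ k : ℕ, 1 ≤ k →
      Helix.IsStripRoot ρ k (Helix.zRoot ρ k) ∧
      (∀ z : ℂ, Helix.IsStripRoot ρ k z → z = Helix.zRoot ρ k) ∧
      deriv (Helix.E ρ) (Helix.zRoot ρ k) ≠ 0 ∧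
      deriv (Helix.E ρ) (Helix.wApprox ρ k) ≠ 0) ∧
    -- both series converge absolutely, and the energy integral converges
    (∀ ρ : ℝ, 0 < ρ →
      Summable (fun k : ℕ => ‖Helix.zTerm ρ (k + 1)‖) ∧
      Summable (fun k : ℕ => ‖Helix.wTerm ρ (k + 1)‖) ∧
      MeasureTheory.Integrable (Helix.M ρ)) ∧
    -- the terms are uniformly `O(ρ)`-perturbations of each other
    (∃ C : ℝ, 0 < C ∧ ∃ ρ₀ : ℝ, 0 < ρ₀ ∧ ∀ ρ : ℝ, 0 < ρ → ρ < ρ₀ → ∀ k : ℕ, 1 ≤ k →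
      ∃ η : ℂ, ‖η‖ ≤ C * ρ ∧ Helix.zTerm ρ k = (1 + η) * Helix.wTerm ρ k) ∧
    -- `J ∼ J̃`
    Helix.AsympEquivAtZero Helix.J Helix.JTilde ∧
    -- `I ∼ log (1 / ρ) / ρ`
    Helix.AsympEquivAtZero Helix.I (fun ρ : ℝ => Real.log (1 / ρ) / ρ) := by
  refine ⟨fun ρ hρ k hk => ?_, fun ρ hρ => ⟨Helix.summable_norm_zTerm hρ,
    Helix.summable_norm_wTerm hρ, Helix.integrable_M hρ⟩,
    ⟨56, by norm_num, 1 / 104, by norm_num, fun ρ hρ hlt k hk =>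
      Helix.exists_zTerm_eq hρ hlt.le hk⟩,
    Helix.asympEquivAtZero_J_JTilde, Helix.asympEquivAtZero_I⟩
  obtain ⟨w, hw, hz, huniq⟩ := Helix.exists_zRoot_eq hρ hk
  rw [hz]
  exact ⟨(Helix.isStripRoot_stripPoint_iff hρ hk w).2 hw, huniq,
    Helix.ne_zero_of_le_norm hρ hk (hw.le_norm_deriv_E hρ hk),
    Helix.ne_zero_of_le_norm hρ hk (Helix.le_norm_deriv_E_wApprox hρ k)⟩
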